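/- Let $n = p_1 p_2 \cdots p_d$ be a squarefree integer $n > 1$, where $d \ge 1$ and $p_1, \dots, p_d$ are primes, let $\phi$ be Euler's function, and write the $n$-th cyclotomic polynomial as $\Phi_n(x) = \sum_{j=0}^{\phi(n)} c_j x^j$ with $c_j \in \mathbb{Z}$. Let $K_{p_1,\dots,p_d}$ be the complete $d$-partite simplicial complex, i.e. the simplicial join of the $0$-dimensional complexes with vertex sets $\mathbb{Z}/p_1\mathbb{Z}, \dots, \mathbb{Z}/p_d\mathbb{Z}$. For an integer $\ell$ let $F_\ell$ be its facet $\{\ell \bmod p_1, \dots, \ell \bmod p_d\}$ (by the Chinese Remainder Theorem these facets are indexed by the residues $\ell$ modulo $n$). For $0 \le j \le \phi(n)$ let $K_{\{j\}}$ be the subcomplex of $K_{p_1,\dots,p_d}$ generated by the facets $F_\ell$ with $\ell \in \{j\} \cup \{\phi(n)+1, \phi(n)+2, \dots, n-1\}$. Then, for every $j$ with $0 \le j \le \phi(n)$, the reduced simplicial homology of $K_{\{j\}}$ with integer coefficients is, for $i \in \mathbb{Z}$, $$ \tilde{H}_i(K_{\{j\}};\mathbb{Z}) \cong \begin{cases}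 \mathbb{Z}/c_j\mathbb{Z} & \text{if } i = d-2,\\ \mathbb{Z} & \text{if both } i = d-1 \text{ and } c_j = 0,\\ 0 & \text{otherwise.} \end{cases} $$ -/

import Mathlib

namespace SimplicialHomology

/-- The simplicial boundary operator on the free abelian group on all finite subsets of a linearly
ordered vertex set. A finite set `s = {v₀ < ⋯ < vₖ}` stands for the oriented simplex
`[v₀, …, vₖ]`, and `∂ [v₀, …, vₖ] = ∑ₘ (-1)ᵐ [v₀, …, v̂ₘ, …, vₖ]`. In particular
`∂ [v] = [∅]` (the augmentation) and `∂ [∅] = 0`. -/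
noncomputable def boundary (V : Type*) [LinearOrder V] :
    (Finset V →₀ ℤ) →ₗ[ℤ] (Finset V →₀ ℤ) :=
  Finsupp.linearCombination ℤ fun s : Finset V =>
    ∑ v ∈ s, Finsupp.single (s.erase v) ((-1 : ℤ) ^ (s.filter (· < v)).card)

/-- The group `C̃ᵢ(K; ℤ)` of `i`-dimensional chains of `K`, for all `i : ℤ`: it is free on
the faces of `K` with `i + 1` vertices, where the empty face (of dimension `-1`) is included. -/
def chains {V : Type*} (K : PreAbstractSimplicialComplex V) (i : ℤ) :
    Submodule ℤ (Finset V →₀ ℤ) :=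
  Finsupp.supported ℤ ℤ {s : Finset V | (s ∈ K ∨ s = ∅) ∧ (s.card : ℤ) = i + 1}

/-- The reduced `i`-cycles of `K`. -/
noncomputable def cycles {V : Type*} [LinearOrder V] (K : PreAbstractSimplicialComplex V) (i : ℤ) :
    Submodule ℤ (Finset V →₀ ℤ) :=
  chains K i ⊓ LinearMap.ker (boundary V)

/-- The `i`-boundaries of `K`. -/
noncomputable def boundaries {V : Type*} [LinearOrder V] (K : PreAbstractSimplicialComplex V)
    (i : ℤ) : Submodule ℤ (Finset V →₀ ℤ) :=
  (chains K (i + 1)).map (boundary V)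

theorem boundary_single {V : Type*} [LinearOrder V] (s : Finset V) (a : ℤ) :
    boundary V (Finsupp.single s a) =
      a • ∑ v ∈ s, Finsupp.single (s.erase v) ((-1 : ℤ) ^ (s.filter (· < v)).card) := by
  simp [boundary, Finsupp.linearCombination_single]

/-- The boundary operator squares to zero. -/
theorem boundary_boundary {V : Type*} [LinearOrder V] (x : Finset V →₀ ℤ) :
    boundary V (boundary V x) = 0 := by
  suffices h : boundary V ∘ₗ boundary V = 0 from LinearMap.congr_fun h x
  refine Finsupp.lhom_ext fun s a => ?_
  simp only [LinearMap.comp_apply, boundary_single, map_smul, map_sum, LinearMap.zero_apply]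
  simp only [Finset.smul_sum, Finsupp.smul_single, smul_eq_mul]
  rw [Finset.sum_sigma']
  refine Finset.sum_involution (fun q _ => ⟨q.2, q.1⟩) ?_ ?_ ?_ ?_
  · rintro ⟨v, w⟩ h
    simp only [Finset.mem_sigma, Finset.mem_erase] at h
    obtain ⟨hv, hwv, hw⟩ := h
    have key : ∀ v w : V, v ∈ s → v < w →
        ((s.filter (· < w)).card = ((s.erase v).filter (· < w)).card + 1 ∧
          ((s.erase w).filter (· < v)).card = (s.filter (· < v)).card) := by
      intro v w hv hvw
      constructor
      · rw [Finset.filter_erase, Finset.card_erase_add_one]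
        simp [hv, hvw]
      · rw [Finset.filter_erase, Finset.erase_eq_of_notMem]
        simp [hvw.le]
    simp only [Finset.erase_right_comm (a := w) (b := v), ← Finsupp.single_add]
    rw [Finsupp.single_eq_zero]
    rcases lt_or_gt_of_ne hwv with hlt | hlt
    · obtain ⟨h1, h2⟩ := key w v hw hlt
      rw [h1, h2]; ring
    · obtain ⟨h1, h2⟩ := key v w hv hlt
      rw [h1, h2]; ring
  · rintro ⟨v, w⟩ h _ heq
    simp only [Finset.mem_sigma, Finset.mem_erase] at h
    simp only [Sigma.mk.injEq, heq_eq_eq] at heq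
    exact h.2.1 heq.1
  · rintro ⟨v, w⟩ h
    simp only [Finset.mem_sigma, Finset.mem_erase] at h ⊢
    exact ⟨h.2.2, h.2.1.symm, h.1⟩
  · rintro ⟨v, w⟩ _
    rfl

/-- The boundary operator maps `C̃ᵢ₊₁(K; ℤ)` to `C̃ᵢ(K; ℤ)`, so that boundaries are cycles. -/
theorem boundaries_le_cycles {V : Type*} [LinearOrder V] (K : PreAbstractSimplicialComplex V)
    (i : ℤ) : boundaries K i ≤ cycles K i := by
  refine le_inf ?_ ?_
  · rw [boundaries, chains, Finsupp.supported_eq_span_single, Submodule.map_span_le]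
    rintro _ ⟨s, ⟨hs, hc⟩, rfl⟩
    rw [boundary_single, one_smul]
    refine Submodule.sum_mem _ fun v hv => Finsupp.single_mem_supported ℤ _ ⟨?_, ?_⟩
    · rcases hs with hs | rfl
      · rcases (s.erase v).eq_empty_or_nonempty with h | h
        · exact Or.inr h
        · exact Or.inl ((K.isRelLowerSet_faces hs).2 (s.erase_subset v) h)
      · simp at hv
    · have := Finset.card_erase_add_one hv
      lia
  · rintro _ ⟨x, _, rfl⟩
    exact boundary_boundary x

/-- Reduced simplicial homology `H̃ᵢ(K; ℤ)` of an abstract simplicial complex on a linearly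
ordered vertex set, for all `i : ℤ`: reduced cycles modulo boundaries. -/
abbrev reducedHomology {V : Type*} [LinearOrder V] (K : PreAbstractSimplicialComplex V) (i : ℤ) :
    Type _ :=
  cycles K i ⧸ (boundaries K i).submoduleOf (cycles K i)

end SimplicialHomology

namespace CyclotomicComplex

/-- The vertex set of `K_{p₁,…,p_d}`: the vertex `(i, r)` with `r < pᵢ` is the residue
class `r mod pᵢ`. It is ordered lexicographically, so that the simplices are oriented by
listing the residues in increasing order of `i`. -/
abbrev Vertex {d : ℕ} (p : Fin d → ℕ) : Type := Σₗ i : Fin d, Fin (p i)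

/-- The complete `d`-partite complex `K_{p₁,…,p_d}`, the simplicial join of the
zero-dimensional complexes `K_{pᵢ}` with `pᵢ` vertices: a nonempty set of vertices
is a face when it contains at most one vertex of each `K_{pᵢ}`. -/
def completePartite {d : ℕ} (p : Fin d → ℕ) : PreAbstractSimplicialComplex (Vertex p) where
  faces := {s | s.Nonempty ∧
    ∀ v ∈ s, ∀ w ∈ s, (ofLex v).1 = (ofLex w).1 → v = w}
  isRelLowerSet_faces := fun _ hs =>
    ⟨hs.1, fun _ hts ht => ⟨ht, fun v hv w hw => hs.2 v (hts hv) w (hts hw)⟩⟩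

/-- The facet `F_{ℓ mod n}` of `K_{p₁,…,p_d}`: it consists of the residue classes
`ℓ mod pᵢ` for `i = 1, …, d`. -/
def facet {d : ℕ} (p : Fin d → ℕ) (l : ℕ) : Finset (Vertex p) :=
  {v : Vertex p | ((ofLex v).2 : ℕ) = l % p (ofLex v).1}

/-- For `n = p₁ ⋯ p_d`, the subcomplex `K_A` of `K_{p₁,…,p_d}` that is generated by
the facets `F_{ℓ mod n}` for `ℓ ∈ A ∪ {φ(n) + 1, …, n - 1}`. -/
def subcomplex {d : ℕ} (p : Fin d → ℕ) (A : Set ℕ) : PreAbstractSimplicialComplex (Vertex p) where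
  faces := {s | s.Nonempty ∧
    ∃ l ∈ A ∪ Set.Ioo (Nat.totient (∏ i, p i)) (∏ i, p i), s ⊆ facet p l}
  isRelLowerSet_faces := fun _ ⟨hs, l, hl, hsl⟩ =>
    ⟨hs, fun _ hts ht => ⟨ht, l, hl, hts.trans hsl⟩⟩

theorem subcomplex_le {d : ℕ} (p : Fin d → ℕ) (A : Set ℕ) :
    subcomplex p A ≤ completePartite p := by
  rintro s ⟨hs, l, -, hsl⟩
  refine ⟨hs, ?_⟩
  rintro ⟨i, a⟩ hv ⟨i', b⟩ hw (rfl : i = i')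
  have ha := (Finset.mem_filter.1 (hsl hv)).2
  have hb := (Finset.mem_filter.1 (hsl hw)).2
  have hab : a = b := Fin.ext (ha.trans hb.symm)
  rw [hab]

end CyclotomicComplex

/-!
Write `Φ` for the `n`-th cyclotomic polynomial and `Ψ = (Xⁿ - 1) / Φ` (`cocyclotomic n`). Sending
`X ^ l` to the facet `F_l` identifies the polynomials modulo `Xⁿ - 1` with the top-dimensional
chains of the complete partite complex `K`. The coefficients of the boundary of a chain at the
faces that miss the `k`-th part are, up to a sign, the coefficients of the polynomial modulo
`X ^ (n / pₖ) - 1`. So a polynomial is a cycle if and only if all `X ^ (n / pₖ) - 1` divide it, that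
is, if and only if `Ψ` does (`boundary_polyChain_facet_eq_zero_iff_cocyclotomic_dvd`).

The complex `K` is acyclic below its top dimension `d - 1`: coning off with a vertex of each part in
turn deforms a cycle to one supported on simplices that meet all parts
(`cycles_completePartite_le_boundaries`). The subcomplex `K_{j}` contains the whole
`(d - 2)`-skeleton of `K` (`mem_subcomplex_of_card_lt`). Hence only the homology in the dimensions
`d - 1` and `d - 2` matters, and the latter is the quotient of the polynomials of degree less than
`n` by the multiples of `Ψ` and by the `X ^ l` with `F_l` in `K_{j}`.

That quotient is computed with the functional `L f = (coefficient of X ^ φ(n) in Φ * f)`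
(`cycloFunctional n`). Since `Φ * Ψ = Xⁿ - 1`, it vanishes on the multiples of `Ψ` of degree less
than `n`, and since `Ψ` is minus the inverse of `Φ` modulo `Xⁿ`, its kernel there consists of the sums of
such a multiple and a polynomial divisible by `X ^ (φ(n) + 1)`. As `Φ` is palindromic, `L (X ^ j)` is
the coefficient `cⱼ`, so `L` induces the isomorphism with `ℤ / cⱼ ℤ`
(`nonempty_reducedHomology_equiv`). A top-dimensional cycle of `K_{j}` is determined by its
coefficient `a` at `F_j`, and `a * cⱼ = 0`; when `cⱼ = 0`, each `a` occurs
(`nonempty_reducedHomology_top_equiv`).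
-/

/-! ### The coefficient functional of the cyclotomic polynomial -/

namespace CyclotomicComplex

open Polynomial

/-- The product of the cyclotomic polynomials `Φₘ` over the proper divisors `m` of `n`, so that
`Φₙ * cocyclotomic n = Xⁿ - 1`. -/
noncomputable def cocyclotomic (n : ℕ) : ℤ[X] := ∏ m ∈ n.properDivisors, cyclotomic m ℤ

theorem cyclotomic_mul_cocyclotomic {n : ℕ} (hn : 0 < n) :
    cyclotomic n ℤ * cocyclotomic n = X ^ n - 1 := by
  rw [← prod_cyclotomic_eq_X_pow_sub_one hn, ← Nat.insert_self_properDivisors hn.ne',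
    Finset.prod_insert Nat.self_notMem_properDivisors, cocyclotomic]

theorem cocyclotomic_monic (n : ℕ) : (cocyclotomic n).Monic :=
  monic_prod_of_monic _ _ fun m _ => cyclotomic.monic m ℤ

theorem totient_add_natDegree_cocyclotomic {n : ℕ} (hn : 0 < n) :
    n.totient + (cocyclotomic n).natDegree = n := by
  have h := congrArg natDegree (cyclotomic_mul_cocyclotomic hn)
  rwa [(cyclotomic.monic n ℤ).natDegree_mul (cocyclotomic_monic n), natDegree_cyclotomic,
    natDegree_sub_eq_left_of_natDegree_lt (by simpa using hn), natDegree_X_pow] at h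

/-- The polynomials `Xᵐ - 1`, for `m = n / q` with `q` a prime divisor of `n`, have the least
common multiple `cocyclotomic n`. -/
theorem cocyclotomic_dvd_iff {n : ℕ} (hn : 0 < n) (f : ℤ[X]) :
    cocyclotomic n ∣ f ↔ ∀ q, q.Prime → q ∣ n → (X ^ (n / q) - 1 : ℤ[X]) ∣ f := by
  constructor
  · intro h q hq hqn
    have hpos : 0 < n / q := Nat.div_pos (Nat.le_of_dvd hn hqn) hq.pos
    refine dvd_trans ?_ h
    rw [← prod_cyclotomic_eq_X_pow_sub_one hpos]
    refine Finset.prod_dvd_prod_of_subset _ _ _ fun m hm => ?_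
    rw [Nat.mem_properDivisors]
    have hm' := Nat.dvd_of_mem_divisors hm
    exact ⟨hm'.trans (Nat.div_dvd_of_dvd hqn),
      (Nat.le_of_dvd hpos hm').trans_lt (Nat.div_lt_self hn hq.one_lt)⟩
  · intro h
    refine Finset.prod_dvd_of_isRelPrime ?_ ?_
    · intro a ha b hb hab
      have ha0 : 0 < a := Nat.pos_of_mem_properDivisors ha
      have hb0 : 0 < b := Nat.pos_of_mem_properDivisors hb
      refine ((cyclotomic.irreducible ha0).isRelPrime_iff_not_dvd).2 fun hd => hab ?_
      have := ((cyclotomic.irreducible ha0).associated_of_dvd (cyclotomic.irreducible hb0) hd)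
      exact cyclotomic_injective
        (eq_of_monic_of_associated (cyclotomic.monic _ _) (cyclotomic.monic _ _) this)
    · intro m hm
      rw [Nat.mem_properDivisors] at hm
      obtain ⟨⟨k, rfl⟩, hlt⟩ := hm
      have hk : k ≠ 1 := by rintro rfl; simp at hlt
      obtain ⟨q, hq, c, rfl⟩ := Nat.exists_prime_and_dvd hk
      refine dvd_trans ?_ (h q hq ⟨m * c, by ring⟩)
      rw [show m * (q * c) = q * (m * c) by ring, Nat.mul_div_cancel_left _ hq.pos]
      exact (cyclotomic.dvd_X_pow_sub_one m ℤ).trans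
        (pow_one_sub_dvd_pow_mul_sub_one X m c)

/-- Cyclotomic polynomials are palindromic: the inverse of a primitive `n`-th root of unity is a
primitive `n`-th root of unity. -/
theorem cyclotomic_reverse {n : ℕ} (hn : 1 < n) :
    (cyclotomic n ℤ).reverse = cyclotomic n ℤ := by
  have h0 : (cyclotomic n ℤ).coeff 0 = 1 := cyclotomic_coeff_zero ℤ hn
  have htr : (cyclotomic n ℤ).natTrailingDegree = 0 :=
    natTrailingDegree_eq_zero.2 (Or.inr (by simp [h0]))
  have hmon : (cyclotomic n ℤ).reverse.Monic := by
    rw [Monic, reverse_leadingCoeff, trailingCoeff, htr, h0]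
  have hζ := Complex.isPrimitiveRoot_exp n (by lia)
  set ζ := Complex.exp (2 * Real.pi * Complex.I / n)
  have hroot : aeval ζ (cyclotomic n ℤ).reverse = 0 := by
    let u : Invertible ζ⁻¹ := invertibleOfNonzero (inv_ne_zero (hζ.ne_zero (by lia)))
    have := (eval₂_reverse_eq_zero_iff (algebraMap ℤ ℂ) ζ⁻¹ (cyclotomic n ℤ)).2 (by
      have h1 : IsRoot (cyclotomic n ℂ) ζ⁻¹ := hζ.inv.isRoot_cyclotomic (by lia)
      rw [← map_cyclotomic_int, IsRoot, eval_map] at h1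
      exact h1)
    rwa [invOf_eq_inv, inv_inv] at this
  have hdvd : cyclotomic n ℤ ∣ (cyclotomic n ℤ).reverse := by
    rw [cyclotomic_eq_minpoly hζ (by lia)] at hroot ⊢
    exact minpoly.isIntegrallyClosed_dvd (hζ.isIntegral (by lia)) hroot
  exact eq_of_monic_of_dvd_of_natDegree_le (cyclotomic.monic n ℤ) hmon hdvd
    (reverse_natDegree_le _) |>.symm ▸ rfl

theorem cyclotomic_coeff_totient_sub {n j : ℕ} (hn : 1 < n) (hj : j ≤ n.totient) :
    (cyclotomic n ℤ).coeff (n.totient - j) = (cyclotomic n ℤ).coeff j := by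
  conv_rhs => rw [← cyclotomic_reverse hn, coeff_reverse, natDegree_cyclotomic, revAt_le hj]

/-- The coefficient of `X ^ φ(n)` in `Φₙ * f`, as a functional of `f`. -/
noncomputable def cycloFunctional (n : ℕ) : ℤ[X] →ₗ[ℤ] ℤ :=
  lcoeff ℤ n.totient ∘ₗ LinearMap.mulLeft ℤ (cyclotomic n ℤ)

theorem cycloFunctional_apply (n : ℕ) (f : ℤ[X]) :
    cycloFunctional n f = (cyclotomic n ℤ * f).coeff n.totient := rfl

theorem cycloFunctional_X_pow {n j : ℕ} (hn : 1 < n) (hj : j ≤ n.totient) :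
    cycloFunctional n (X ^ j) = (cyclotomic n ℤ).coeff j := by
  rw [cycloFunctional_apply, coeff_mul_X_pow', if_pos hj, cyclotomic_coeff_totient_sub hn hj]

theorem cycloFunctional_eq_zero_of_X_pow_dvd {n : ℕ} {f : ℤ[X]} (h : X ^ (n.totient + 1) ∣ f) :
    cycloFunctional n f = 0 := by
  rw [cycloFunctional_apply]
  exact X_pow_dvd_iff.1 (dvd_mul_of_dvd_right h _) _ (Nat.lt_succ_self _)

theorem exists_cofactor {n : ℕ} (hn : 0 < n) {f : ℤ[X]} (hf : f.degree < n)
    (h : cocyclotomic n ∣ f) :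
    ∃ g : ℤ[X], f = cocyclotomic n * g ∧ g.degree < n.totient := by
  obtain ⟨g, rfl⟩ := h
  refine ⟨g, rfl, ?_⟩
  rcases eq_or_ne g 0 with rfl | hg
  · simp
  have hne : cocyclotomic n * g ≠ 0 := mul_ne_zero (cocyclotomic_monic n).ne_zero hg
  rw [← natDegree_lt_iff_degree_lt hne, natDegree_mul (cocyclotomic_monic n).ne_zero hg] at hf
  rw [← natDegree_lt_iff_degree_lt hg]
  have := totient_add_natDegree_cocyclotomic hn
  lia

theorem cycloFunctional_eq_zero_of_cocyclotomic_dvd {n : ℕ} (hn : 1 < n) {f : ℤ[X]}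
    (hf : f.degree < n) (h : cocyclotomic n ∣ f) : cycloFunctional n f = 0 := by
  obtain ⟨g, rfl, hg⟩ := exists_cofactor (by lia) hf h
  rw [cycloFunctional_apply, ← mul_assoc, cyclotomic_mul_cocyclotomic (by lia), sub_mul, one_mul,
    coeff_sub, coeff_X_pow_mul', if_neg (by simpa using Nat.totient_lt n hn),
    coeff_eq_zero_of_degree_lt hg, sub_zero]

/-- As `cocyclotomic n` is minus the inverse of `Φₙ` modulo `Xⁿ`, a polynomial that the
functional kills agrees with a multiple of `cocyclotomic n` modulo `X ^ (φ(n) + 1)`. -/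
theorem exists_cocyclotomic_dvd_of_cycloFunctional_eq_zero {n : ℕ} (hn : 1 < n) {f : ℤ[X]}
    (h : cycloFunctional n f = 0) :
    ∃ g : ℤ[X], cocyclotomic n ∣ g ∧ g.degree < n ∧ X ^ (n.totient + 1) ∣ f - g := by
  have hφ := Nat.totient_lt n hn
  -- the truncation of `Φₙ * f` below degree `φ(n)`
  obtain ⟨r, hr, q, hq⟩ : ∃ r : ℤ[X], r.degree < n.totient ∧
      X ^ n.totient ∣ cyclotomic n ℤ * f - r := by
    refine ⟨(cyclotomic n ℤ * f) %ₘ X ^ n.totient, ?_, ?_⟩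
    · simpa using degree_modByMonic_lt (cyclotomic n ℤ * f) (monic_X_pow n.totient)
    · rw [modByMonic_eq_sub_mul_div]
      simp
  have hq1 : X ^ (n.totient + 1) ∣ cyclotomic n ℤ * f - r := by
    rw [X_pow_dvd_iff]
    intro k hk
    rcases Nat.lt_succ_iff_lt_or_eq.1 hk with hk | rfl
    · exact X_pow_dvd_iff.1 ⟨q, hq⟩ k hk
    · rw [coeff_sub, coeff_eq_zero_of_degree_lt hr, sub_zero]
      exact h
  refine ⟨-(cocyclotomic n * r), (dvd_mul_right _ _).neg_right, ?_, ?_⟩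
  · rw [degree_neg]
    rcases eq_or_ne r 0 with rfl | hr0
    · simp
    rw [← natDegree_lt_iff_degree_lt hr0] at hr
    rw [← natDegree_lt_iff_degree_lt (mul_ne_zero (cocyclotomic_monic n).ne_zero hr0),
      natDegree_mul (cocyclotomic_monic n).ne_zero hr0]
    have := totient_add_natDegree_cocyclotomic (n := n) (by lia)
    lia
  · have h1 : f - -(cocyclotomic n * r) =
        X ^ n * f - cocyclotomic n * (cyclotomic n ℤ * f - r) := by
      have := cyclotomic_mul_cocyclotomic (n := n) (by lia)
      linear_combination f * this
    rw [h1]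
    exact dvd_sub ((pow_dvd_pow X (by lia)).mul_right f) (hq1.mul_left _)

theorem eq_zero_of_cocyclotomic_dvd_of_X_pow_dvd {n : ℕ} (hn : 1 < n) {f : ℤ[X]}
    (hf : f.degree < n) (h : cocyclotomic n ∣ f) (hX : X ^ n.totient ∣ f) : f = 0 := by
  obtain ⟨g, rfl, hg⟩ := exists_cofactor (by lia) hf h
  have hφ := Nat.totient_lt n hn
  have h1 : g = X ^ n * g - cyclotomic n ℤ * (cocyclotomic n * g) := by
    have := cyclotomic_mul_cocyclotomic (n := n) (by lia)
    linear_combination g * this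
  have h2 : X ^ n.totient ∣ g := by
    rw [h1]
    exact dvd_sub ((pow_dvd_pow X hφ.le).mul_right g) (hX.mul_left _)
  have h3 : g = 0 := by
    ext k
    by_cases hk : k < n.totient
    · exact X_pow_dvd_iff.1 h2 k hk
    · exact coeff_eq_zero_of_degree_lt (hg.trans_le (by exact_mod_cast not_lt.1 hk))
  rw [h3, mul_zero]

end CyclotomicComplex

/-! ### The cone operator and acyclicity of the complete partite complex -/

namespace SimplicialHomology

variable {V : Type*} [LinearOrder V]

theorem exists_of_mem_support_boundary {x : Finset V →₀ ℤ} {t : Finset V}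
    (ht : t ∈ (boundary V x).support) : ∃ s ∈ x.support, ∃ v ∈ s, t = s.erase v := by
  classical
  rw [boundary, Finsupp.linearCombination_apply] at ht
  obtain ⟨s, hs, hts⟩ := Finset.mem_biUnion.1 (Finsupp.support_sum ht)
  obtain ⟨v, hv, h⟩ := Finsupp.mem_support_finsetSum t (Finsupp.support_smul hts)
  exact ⟨s, hs, v, hv, Finset.mem_singleton.1 (Finsupp.support_single_subset h)⟩

/-- The cone operator with apex `b`: it sends a simplex `[v₀, …, vₖ]` without the vertex `b` to
`[b, v₀, …, vₖ]`, written with the vertices in increasing order, and a simplex with the vertex `b`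
to `0`. -/
noncomputable def cone (b : V) : (Finset V →₀ ℤ) →ₗ[ℤ] (Finset V →₀ ℤ) :=
  Finsupp.linearCombination ℤ fun s : Finset V =>
    if b ∈ s then 0 else Finsupp.single (insert b s) ((-1 : ℤ) ^ (s.filter (· < b)).card)

theorem cone_single_of_mem {b : V} {s : Finset V} (h : b ∈ s) (a : ℤ) :
    cone b (Finsupp.single s a) = 0 := by
  simp [cone, h]

theorem cone_single_of_notMem {b : V} {s : Finset V} (h : b ∉ s) (a : ℤ) :
    cone b (Finsupp.single s a) =
      Finsupp.single (insert b s) (a * (-1 : ℤ) ^ (s.filter (· < b)).card) := by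
  simp [cone, h]

theorem exists_of_mem_support_cone {b : V} {x : Finset V →₀ ℤ} {t : Finset V}
    (ht : t ∈ (cone b x).support) : ∃ s ∈ x.support, b ∉ s ∧ t = insert b s := by
  classical
  rw [cone, Finsupp.linearCombination_apply] at ht
  obtain ⟨s, hs, hts⟩ := Finset.mem_biUnion.1 (Finsupp.support_sum ht)
  have h := Finsupp.support_smul hts
  by_cases hb : b ∈ s
  · simp [hb] at h
  · rw [if_neg hb] at h
    exact ⟨s, hs, hb, Finset.mem_singleton.1 (Finsupp.support_single_subset h)⟩

theorem neg_one_pow_card_filter_insert {b v : V} {s : Finset V} (hb : b ∉ s) (hv : v ∈ s) :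
    (-1 : ℤ) ^ (s.filter (· < b)).card * (-1) ^ ((insert b s).filter (· < v)).card =
      -((-1) ^ (s.filter (· < v)).card * (-1) ^ ((s.erase v).filter (· < b)).card) := by
  have hne : b ≠ v := by rintro rfl; exact hb hv
  rcases lt_or_gt_of_ne hne with h | h
  · have h1 : ((insert b s).filter (· < v)).card = (s.filter (· < v)).card + 1 := by
      rw [Finset.filter_insert, if_pos h, Finset.card_insert_of_notMem (by simp [hb])]
    have h2 : (s.erase v).filter (· < b) = s.filter (· < b) := by
      rw [Finset.filter_erase, Finset.erase_eq_of_notMem (by simp [h.le])]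
    rw [h1, h2]; ring
  · have h1 : (insert b s).filter (· < v) = s.filter (· < v) := by
      rw [Finset.filter_insert, if_neg h.not_gt]
    have h2 : (s.filter (· < b)).card = ((s.erase v).filter (· < b)).card + 1 := by
      rw [Finset.filter_erase, Finset.card_erase_add_one (by simp [hv, h])]
    rw [h1, h2]; ring

/-- The cone operator is a contracting homotopy of the full simplex on `V`. -/
theorem boundary_cone_add_cone_boundary (b : V) (x : Finset V →₀ ℤ) :
    boundary V (cone b x) + cone b (boundary V x) = x := by
  suffices h : boundary V ∘ₗ cone b + cone b ∘ₗ boundary V = LinearMap.id from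
    LinearMap.congr_fun h x
  refine Finsupp.lhom_ext fun s a => ?_
  simp only [LinearMap.add_apply, LinearMap.comp_apply, LinearMap.id_apply, boundary_single,
    map_smul, map_sum]
  have hsq (k : ℕ) : (-1 : ℤ) ^ k * (-1) ^ k = 1 := by rw [← mul_pow]; simp
  by_cases hb : b ∈ s
  · rw [cone_single_of_mem hb, map_zero, zero_add, Finset.sum_eq_single_of_mem b hb,
      cone_single_of_notMem (by simp), Finset.insert_erase hb]
    · have : (s.erase b).filter (· < b) = s.filter (· < b) := by
        rw [Finset.filter_erase, Finset.erase_eq_of_notMem (by simp)]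
      rw [this, hsq, Finsupp.smul_single, smul_eq_mul, mul_one]
    · intro v _ hvb
      exact cone_single_of_mem (Finset.mem_erase.2 ⟨hvb.symm, hb⟩) _
  · have hfil : (insert b s).filter (· < b) = s.filter (· < b) := by
      rw [Finset.filter_insert, if_neg (lt_irrefl b)]
    rw [cone_single_of_notMem hb, boundary_single, Finset.sum_insert hb, Finset.erase_insert hb,
      hfil, smul_add, Finsupp.smul_single, smul_eq_mul, mul_assoc, hsq, mul_one, add_assoc,
      Finset.smul_sum, Finset.smul_sum, ← Finset.sum_add_distrib, Finset.sum_eq_zero, add_zero]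
    intro v hv
    have hne : v ≠ b := by rintro rfl; exact hb hv
    rw [cone_single_of_notMem (by simp [hb]), ← Finset.erase_insert_of_ne hne.symm,
      Finsupp.smul_single, Finsupp.smul_single, ← Finsupp.single_add, Finsupp.single_eq_zero,
      smul_eq_mul, smul_eq_mul]
    linear_combination a * neg_one_pow_card_filter_insert hb hv

end SimplicialHomology

namespace CyclotomicComplex

open Polynomial SimplicialHomology

variable {d : ℕ} {p : Fin d → ℕ}

theorem mem_chains_iff {V : Type*} {K : PreAbstractSimplicialComplex V} {i : ℤ}
    {x : Finset V →₀ ℤ} :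
    x ∈ chains K i ↔ ∀ s ∈ x.support, (s ∈ K ∨ s = ∅) ∧ (s.card : ℤ) = i + 1 := by
  rw [chains, Finsupp.mem_supported]
  rfl

/-- `s` has a vertex in the `k`-th part. -/
def Meets (s : Finset (Vertex p)) (k : Fin d) : Prop := ∃ v ∈ s, (ofLex v).1 = k

theorem mem_completePartite_or_eq_empty {s : Finset (Vertex p)} :
    s ∈ completePartite p ∨ s = ∅ ↔
      ∀ v ∈ s, ∀ w ∈ s, (ofLex v).1 = (ofLex w).1 → v = w := by
  constructor
  · rintro (h | rfl)
    · exact h.2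
    · simp
  · intro h
    rcases s.eq_empty_or_nonempty with h0 | h0
    · exact Or.inr h0
    · exact Or.inl ⟨h0, h⟩

/-- Modulo boundaries, every cycle of dimension `i` of the complete partite complex is supported on
simplices that meet any given set `S` of parts. The cycle is improved one part `k` at a time: if
`y` consists of the terms of the cycle `z` that do not meet the part `k`, then
`z - ∂ (cone b y)`, with `b` in that part, is `(z - y) + cone b (∂ y)`. -/
theorem exists_sub_mem_boundaries_meets (hp : ∀ k, 0 < p k) {i : ℤ} (S : Finset (Fin d))
    {z : Finset (Vertex p) →₀ ℤ} (hz : z ∈ cycles (completePartite p) i) :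
    ∃ z' ∈ cycles (completePartite p) i, z - z' ∈ boundaries (completePartite p) i ∧
      ∀ s ∈ z'.support, ∀ k ∈ S, Meets s k := by
  have hdec : ∀ k, DecidablePred fun s : Finset (Vertex p) => Meets s k :=
    fun k => Classical.decPred _
  induction S using Finset.induction_on with
  | empty => exact ⟨z, hz, by simp, by simp⟩
  | insert k S hk ih =>
    obtain ⟨z', hz', hb, hS⟩ := ih
    let b : Vertex p := toLex ⟨k, ⟨0, hp k⟩⟩
    have hbk : (ofLex b).1 = k := rfl
    set y := z'.filter fun s => ¬ Meets s k with hy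
    set x := z'.filter fun s => Meets s k with hx
    have hxy : x + y = z' := Finsupp.filter_add_filter_not z' _
    have hzc := mem_chains_iff.1 hz'.1
    have hy' : ∀ s ∈ y.support, s ∈ z'.support ∧ ¬ Meets s k := fun s hs => by
      rwa [hy, Finsupp.support_filter, Finset.mem_filter] at hs
    have hx' : ∀ s ∈ x.support, s ∈ z'.support ∧ Meets s k := fun s hs => by
      rwa [hx, Finsupp.support_filter, Finset.mem_filter] at hs
    -- adding `b` to a face that does not meet the part `k` gives a face
    have hins : ∀ s : Finset (Vertex p), (s ∈ completePartite p ∨ s = ∅) → ¬ Meets s k →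
        insert b s ∈ completePartite p := by
      intro s hs hsk
      refine ⟨Finset.insert_nonempty _ _, ?_⟩
      have hs' := mem_completePartite_or_eq_empty.1 hs
      intro v hv w hw hvw
      rcases Finset.mem_insert.1 hv with rfl | hv <;> rcases Finset.mem_insert.1 hw with rfl | hw
      · rfl
      · exact absurd ⟨w, hw, hvw.symm⟩ hsk
      · exact absurd ⟨v, hv, hvw⟩ hsk
      · exact hs' v hv w hw hvw
    have hcone : cone b y ∈ chains (completePartite p) (i + 1) := by
      refine mem_chains_iff.2 fun t ht => ?_
      obtain ⟨s, hs, hbs, rfl⟩ := exists_of_mem_support_cone ht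
      obtain ⟨h1, h2⟩ := hy' s hs
      obtain ⟨h3, h4⟩ := hzc s h1
      refine ⟨Or.inl (hins s h3 h2), ?_⟩
      rw [← h4]
      exact_mod_cast Finset.card_insert_of_notMem hbs
    have hbd : boundary _ (cone b y) ∈ boundaries (completePartite p) i :=
      Submodule.mem_map_of_mem hcone
    refine ⟨z' - boundary _ (cone b y), Submodule.sub_mem _ hz' (boundaries_le_cycles _ _ hbd),
      ?_, ?_⟩
    · rw [← sub_add]
      exact Submodule.add_mem _ hb hbd
    · have hz'' : z' - boundary _ (cone b y) = x + cone b (boundary _ y) := by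
        rw [sub_eq_iff_eq_add, add_assoc, add_comm (cone b _), boundary_cone_add_cone_boundary, hxy]
      have hdy : boundary _ y = -boundary _ x := by
        rw [eq_neg_iff_add_eq_zero, ← map_add, add_comm, hxy]
        exact hz'.2
      intro t ht l hl
      rw [hz''] at ht
      rcases Finset.mem_union.1 (Finsupp.support_add ht) with ht | ht
      · obtain ⟨h1, h2⟩ := hx' t ht
        rcases Finset.mem_insert.1 hl with rfl | hl
        · exact h2
        · exact hS t h1 l hl
      · obtain ⟨s, hs, -, rfl⟩ := exists_of_mem_support_cone ht
        rcases Finset.mem_insert.1 hl with rfl | hl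
        · exact ⟨b, Finset.mem_insert_self _ _, rfl⟩
        have hsk : ¬ Meets s k := by
          obtain ⟨s', hs', v, hv, rfl⟩ := exists_of_mem_support_boundary hs
          rintro ⟨w, hw, hwk⟩
          exact (hy' s' hs').2 ⟨w, Finset.mem_of_mem_erase hw, hwk⟩
        rw [hdy, Finsupp.support_neg] at hs
        obtain ⟨s', hs', v, hv, rfl⟩ := exists_of_mem_support_boundary hs
        obtain ⟨h1, w, hw, hwk⟩ := hx' s' hs'
        -- the vertex that was removed is the one in the part `k`
        have hwv : w = v := by
          by_contra hne
          exact hsk ⟨w, Finset.mem_erase.2 ⟨hne, hw⟩, hwk⟩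
        obtain ⟨u, hu, hul⟩ := hS s' h1 l hl
        refine ⟨u, Finset.mem_insert_of_mem (Finset.mem_erase.2 ⟨?_, hu⟩), hul⟩
        rintro rfl
        rw [hwv, hul] at hwk
        exact hk (hwk ▸ hl)

theorem le_card_of_forall_meets {s : Finset (Vertex p)} (h : ∀ k, Meets s k) : d ≤ s.card := by
  classical
  have : (Finset.univ : Finset (Fin d)) ⊆ s.image fun v => (ofLex v).1 := fun k _ => by
    obtain ⟨v, hv, hk⟩ := h k
    exact Finset.mem_image.2 ⟨v, hv, hk⟩
  simpa using (Finset.card_le_card this).trans Finset.card_image_le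

theorem cycles_completePartite_le_boundaries (hp : ∀ k, 0 < p k) {i : ℤ} (hi : i < (d : ℤ) - 1) :
    cycles (completePartite p) i ≤ boundaries (completePartite p) i := by
  intro z hz
  obtain ⟨z', hz', hb, hS⟩ := exists_sub_mem_boundaries_meets hp Finset.univ hz
  have h0 : z' = 0 := by
    rw [← Finsupp.support_eq_empty, Finset.eq_empty_iff_forall_notMem]
    intro s hs
    have h1 := le_card_of_forall_meets fun k => hS s hs k (Finset.mem_univ k)
    have h2 := (mem_chains_iff.1 hz'.1 s hs).2
    lia
  rwa [h0, sub_zero] at hb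

/-! ### Polynomials as chains on a family of simplices indexed by residue classes -/

/-- The polynomials all of whose exponents lie in `A`. -/
def supportedIn (A : Set ℕ) : Submodule ℤ ℤ[X] where
  carrier := {f | ∀ l, l ∉ A → f.coeff l = 0}
  add_mem' hf hg l hl := by rw [coeff_add, hf l hl, hg l hl, add_zero]
  zero_mem' l _ := coeff_zero l
  smul_mem' a f hf l hl := by rw [coeff_smul, hf l hl, smul_zero]

theorem mem_supportedIn {A : Set ℕ} {f : ℤ[X]} :
    f ∈ supportedIn A ↔ ∀ l, l ∉ A → f.coeff l = 0 := Iff.rfl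

theorem mem_supportedIn_Iio {n : ℕ} {f : ℤ[X]} : f ∈ supportedIn (Set.Iio n) ↔ f.degree < n := by
  simp [mem_supportedIn, degree_lt_iff_coeff_zero]

theorem X_pow_mem_supportedIn {A : Set ℕ} {j : ℕ} (hj : j ∈ A) : (X ^ j : ℤ[X]) ∈ supportedIn A :=
  fun l hl => by rw [coeff_X_pow, if_neg]; rintro rfl; exact hl hj

theorem supportedIn_mono {A B : Set ℕ} (h : A ⊆ B) : supportedIn A ≤ supportedIn B :=
  fun _ hf l hl => hf l fun hA => hl (h hA)

variable {T : Type*}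

/-- The linear map that sends `X ^ l` to the generator `F l`. -/
noncomputable def polyChain (F : ℕ → T) : ℤ[X] →ₗ[ℤ] (T →₀ ℤ) :=
  Polynomial.lsum fun l => Finsupp.lsingle (F l)

theorem polyChain_monomial (F : ℕ → T) (l : ℕ) (a : ℤ) :
    polyChain F (monomial l a) = Finsupp.single (F l) a := by
  rw [polyChain, lsum_apply]
  exact sum_monomial_index a _ (Finsupp.single_zero _)

theorem map_polyChain_supportedIn (F : ℕ → T) (A : Set ℕ) :
    (supportedIn A).map (polyChain F) = Finsupp.supported ℤ ℤ (F '' A) := by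
  apply le_antisymm
  · rintro _ ⟨f, hf, rfl⟩
    rw [polyChain, lsum_apply, sum_def]
    refine Submodule.sum_mem _ fun l hl => Finsupp.single_mem_supported ℤ _ ⟨l, ?_, rfl⟩
    by_contra h
    exact mem_support_iff.1 hl (hf l h)
  · rw [Finsupp.supported_eq_span_single, Submodule.span_le]
    rintro _ ⟨_, ⟨l, hl, rfl⟩, rfl⟩
    refine ⟨monomial l 1, ?_, polyChain_monomial F l 1⟩
    rw [monomial_one_right_eq_X_pow]
    exact X_pow_mem_supportedIn hl

variable {F : ℕ → T} {m : ℕ}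

theorem polyChain_apply_of_degree_lt (hF : ∀ l l', F l = F l' ↔ l ≡ l' [MOD m]) {f : ℤ[X]}
    (hf : f.degree < m) {l : ℕ} (hl : l < m) : polyChain F f (F l) = f.coeff l := by
  rw [polyChain, lsum_apply, sum_def, Finsupp.finsetSum_apply]
  rw [Finset.sum_eq_single l]
  · simp
  · intro k hk hkl
    have hkm : k < m := by
      by_contra h
      exact mem_support_iff.1 hk (degree_lt_iff_coeff_zero f m |>.1 hf k (not_lt.1 h))
    rw [Finsupp.lsingle_apply, Finsupp.single_eq_of_ne]
    intro h
    exact hkl (((hF _ _).1 h).symm.eq_of_lt_of_lt hkm hl)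
  · intro h
    simp [notMem_support_iff.1 h]

/-- If `F` identifies exactly the exponents that are congruent modulo `m`, then `polyChain F` is
the reduction modulo `Xᵐ - 1`. -/
theorem polyChain_eq_zero_iff (hm : 0 < m) (hF : ∀ l l', F l = F l' ↔ l ≡ l' [MOD m]) (f : ℤ[X]) :
    polyChain F f = 0 ↔ (X ^ m - 1 : ℤ[X]) ∣ f := by
  have hmul (q : ℤ[X]) : polyChain F ((X ^ m - 1) * q) = 0 := by
    induction q using Polynomial.induction_on' with
    | add q r hq hr => rw [mul_add, map_add, hq, hr, add_zero]
    | monomial l a =>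
      rw [sub_mul, one_mul, ← monomial_one_right_eq_X_pow, monomial_mul_monomial, one_mul, map_sub,
        polyChain_monomial, polyChain_monomial, (hF (m + l) l).2 (by simp [Nat.ModEq]), sub_self]
  have hmon : (X ^ m - 1 : ℤ[X]).Monic := monic_X_pow_sub_C 1 hm.ne'
  constructor
  · intro h
    rw [← modByMonic_eq_zero_iff_dvd hmon]
    set r := f %ₘ (X ^ m - 1) with hr
    have hdeg : r.degree < m := by
      have := degree_modByMonic_lt f hmon
      rwa [← C_1, degree_X_pow_sub_C hm] at this
    have hzero : polyChain F r = 0 := by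
      rw [hr, modByMonic_eq_sub_mul_div, map_sub, hmul, h, sub_zero]
    ext l
    rcases lt_or_ge l m with hl | hl
    · rw [← polyChain_apply_of_degree_lt hF hdeg hl, hzero, Finsupp.zero_apply, coeff_zero]
    · rw [degree_lt_iff_coeff_zero _ _ |>.1 hdeg l hl, coeff_zero]
  · rintro ⟨q, rfl⟩
    exact hmul q

/-! ### Facets and their codimension one faces -/

/-- The face of `facet p l` that is spanned by its vertices in the parts of `T`. -/
def subfacet (p : Fin d → ℕ) (T : Finset (Fin d)) (l : ℕ) : Finset (Vertex p) :=
  (facet p l).filter fun v => (ofLex v).1 ∈ T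

theorem mem_facet {l : ℕ} {v : Vertex p} :
    v ∈ facet p l ↔ ((ofLex v).2 : ℕ) = l % p (ofLex v).1 := by
  simp [facet]

/-- The vertex of `facet p l` in the `k`-th part. -/
def vertexOf (hp : ∀ k, 0 < p k) (l : ℕ) (k : Fin d) : Vertex p :=
  toLex ⟨k, ⟨l % p k, Nat.mod_lt _ (hp k)⟩⟩

theorem vertexOf_injective (hp : ∀ k, 0 < p k) (l : ℕ) : Function.Injective (vertexOf hp l) :=
  fun _ _ h => congrArg (fun v : Vertex p => (ofLex v).1) h

theorem vertexOf_mem_facet (hp : ∀ k, 0 < p k) (l : ℕ) (k : Fin d) :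
    vertexOf hp l k ∈ facet p l := mem_facet.2 rfl

theorem eq_vertexOf_of_mem_facet (hp : ∀ k, 0 < p k) {l : ℕ} {v : Vertex p} (hv : v ∈ facet p l) :
    v = vertexOf hp l (ofLex v).1 := by
  obtain ⟨i, a⟩ := v
  have ha : (a : ℕ) = l % p i := mem_facet.1 hv
  have : a = ⟨l % p i, Nat.mod_lt _ (hp i)⟩ := Fin.ext ha
  rw [this]
  rfl

theorem facet_eq_map (hp : ∀ k, 0 < p k) (l : ℕ) :
    facet p l = Finset.univ.map ⟨vertexOf hp l, vertexOf_injective hp l⟩ := by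
  ext v
  simp only [Finset.mem_map, Finset.mem_univ, true_and, Function.Embedding.coeFn_mk]
  constructor
  · exact fun hv => ⟨_, (eq_vertexOf_of_mem_facet hp hv).symm⟩
  · rintro ⟨k, rfl⟩
    exact vertexOf_mem_facet hp l k

theorem card_facet (hp : ∀ k, 0 < p k) (l : ℕ) : (facet p l).card = d := by
  rw [facet_eq_map hp, Finset.card_map, Finset.card_fin]

theorem vertexOf_lt_iff (hp : ∀ k, 0 < p k) (l : ℕ) {i k : Fin d} :
    vertexOf hp l i < vertexOf hp l k ↔ i < k := by
  rw [Sigma.Lex.lt_def]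
  constructor
  · rintro (h | ⟨h, h'⟩)
    · exact h
    · obtain rfl : i = k := h
      exact absurd h' (lt_irrefl _)
  · exact fun h => Or.inl h

theorem boundary_single_facet (hp : ∀ k, 0 < p k) (l : ℕ) (a : ℤ) :
    boundary (Vertex p) (Finsupp.single (facet p l) a) =
      ∑ k : Fin d, (-1) ^ (k : ℕ) • Finsupp.single (subfacet p (Finset.univ.erase k) l) a := by
  rw [boundary_single, Finset.smul_sum]
  conv_lhs => rw [facet_eq_map hp, Finset.sum_map, ← facet_eq_map hp]
  refine Finset.sum_congr rfl fun k _ => ?_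
  have h1 : ((facet p l).filter (· < vertexOf hp l k)).card = k := by
    rw [facet_eq_map hp, Finset.filter_map, Finset.card_map]
    simp only [Function.comp_def, Function.Embedding.coeFn_mk, vertexOf_lt_iff]
    rw [Finset.filter_gt_eq_Iio, Fin.card_Iio]
  have h2 (inst : DecidableEq (Vertex p)) : @Finset.erase _ inst (facet p l) (vertexOf hp l k) =
      subfacet p (Finset.univ.erase k) l := by
    ext v
    rw [subfacet, Finset.mem_erase, Finset.mem_filter, and_comm]
    refine and_congr_right fun hv => ?_
    simp only [Finset.mem_erase, Finset.mem_univ, and_true]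
    refine not_congr ⟨fun h => by rw [h]; rfl, fun h => ?_⟩
    rw [← h]
    exact eq_vertexOf_of_mem_facet hp hv
  simp only [Function.Embedding.coeFn_mk]
  rw [h1, h2, Finsupp.smul_single, Finsupp.smul_single, smul_eq_mul, smul_eq_mul, mul_comm]

theorem boundary_polyChain_facet (hp : ∀ k, 0 < p k) (f : ℤ[X]) :
    boundary (Vertex p) (polyChain (facet p) f) =
      ∑ k : Fin d, (-1) ^ (k : ℕ) • polyChain (subfacet p (Finset.univ.erase k)) f := by
  induction f using Polynomial.induction_on' with
  | add f g hf hg => simp only [map_add, hf, hg, smul_add, Finset.sum_add_distrib]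
  | monomial l a => simp only [polyChain_monomial, boundary_single_facet hp]

theorem modEq_prod_iff (hcop : Pairwise (Function.onFun Nat.Coprime p)) (T : Finset (Fin d))
    (l l' : ℕ) :
    l ≡ l' [MOD ∏ k ∈ T, p k] ↔ ∀ k ∈ T, l ≡ l' [MOD p k] := by
  refine ⟨fun h k hk => h.of_dvd (Finset.dvd_prod_of_mem p hk), fun h => ?_⟩
  rw [Nat.modEq_iff_dvd, Nat.cast_prod]
  exact Finset.prod_dvd_of_coprime (fun i _ k _ hik => Nat.isCoprime_iff_coprime.2 (hcop hik))
    fun k hk => Nat.modEq_iff_dvd.1 (h k hk)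

theorem subfacet_eq_iff (hp : ∀ k, 0 < p k) (hcop : Pairwise (Function.onFun Nat.Coprime p))
    (T : Finset (Fin d)) (l l' : ℕ) :
    subfacet p T l = subfacet p T l' ↔ l ≡ l' [MOD ∏ k ∈ T, p k] := by
  rw [modEq_prod_iff hcop]
  constructor
  · intro h k hk
    have h1 : vertexOf hp l k ∈ subfacet p T l' :=
      h ▸ Finset.mem_filter.2 ⟨vertexOf_mem_facet hp l k, hk⟩
    exact mem_facet.1 (Finset.mem_filter.1 h1).1
  · intro h
    ext v
    rw [subfacet, subfacet, Finset.mem_filter, Finset.mem_filter]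
    refine and_congr_left fun hv => ?_
    rw [mem_facet, mem_facet, h _ hv]

theorem facet_eq_subfacet (l : ℕ) : facet p l = subfacet p Finset.univ l := by
  simp [subfacet]

theorem facet_eq_iff (hp : ∀ k, 0 < p k) (hcop : Pairwise (Function.onFun Nat.Coprime p))
    (l l' : ℕ) :
    facet p l = facet p l' ↔ l ≡ l' [MOD ∏ k, p k] := by
  rw [facet_eq_subfacet, facet_eq_subfacet, subfacet_eq_iff hp hcop]

/-- The faces of `∂ (polyChain (facet p) f)` that miss the `k`-th part only come from the `k`-th
term of the boundary. -/
theorem boundary_polyChain_facet_eq_zero_iff (hp : ∀ k, 0 < p k) (f : ℤ[X]) :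
    boundary (Vertex p) (polyChain (facet p) f) = 0 ↔
      ∀ k, polyChain (subfacet p (Finset.univ.erase k)) f = 0 := by
  rw [boundary_polyChain_facet hp]
  refine ⟨fun h k => ?_, fun h => Finset.sum_eq_zero fun k _ => by rw [h k, smul_zero]⟩
  have hsupp (i : Fin d) : polyChain (subfacet p (Finset.univ.erase i)) f ∈
      Finsupp.supported ℤ ℤ (Set.range (subfacet p (Finset.univ.erase i))) := by
    rw [← Set.image_univ, ← map_polyChain_supportedIn]
    exact Submodule.mem_map_of_mem fun l hl => absurd (Set.mem_univ l) hl
  rw [← Finsupp.support_eq_empty, Finset.eq_empty_iff_forall_notMem]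
  intro t ht
  obtain ⟨l, rfl⟩ := (Finsupp.mem_supported _ _).1 (hsupp k) ht
  have h1 := DFunLike.congr_fun h (subfacet p (Finset.univ.erase k) l)
  rw [Finsupp.finsetSum_apply, Finset.sum_eq_single k] at h1
  · rw [Finsupp.smul_apply, Finsupp.zero_apply, smul_eq_mul, mul_eq_zero] at h1
    exact Finsupp.mem_support_iff.1 ht (h1.resolve_left (by simp))
  · intro i _ hik
    rw [Finsupp.smul_apply, Finsupp.notMem_support_iff.1, smul_zero]
    intro hi
    obtain ⟨l', hl'⟩ := (Finsupp.mem_supported _ _).1 (hsupp i) hi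
    have h2 : vertexOf hp l' k ∈ subfacet p (Finset.univ.erase k) l :=
      hl' ▸ Finset.mem_filter.2 ⟨vertexOf_mem_facet hp l' k,
        Finset.mem_erase.2 ⟨hik.symm, Finset.mem_univ _⟩⟩
    exact (Finset.mem_erase.1 (Finset.mem_filter.1 h2).2).1 rfl
  · exact fun hk => absurd (Finset.mem_univ k) hk

/-- The top-dimensional cycles of the complete partite complex are the multiples of
`cocyclotomic n`. -/
theorem boundary_polyChain_facet_eq_zero_iff_cocyclotomic_dvd (hp : ∀ k, (p k).Prime)
    (hcop : Pairwise (Function.onFun Nat.Coprime p)) (f : ℤ[X]) :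
    boundary (Vertex p) (polyChain (facet p) f) = 0 ↔ cocyclotomic (∏ k, p k) ∣ f := by
  have hp0 : ∀ k, 0 < p k := fun k => (hp k).pos
  have hdiv (k : Fin d) : (∏ i, p i) / p k = ∏ i ∈ Finset.univ.erase k, p i := by
    rw [← Finset.mul_prod_erase _ _ (Finset.mem_univ k), Nat.mul_div_cancel_left _ (hp0 k)]
  rw [boundary_polyChain_facet_eq_zero_iff hp0,
    cocyclotomic_dvd_iff (Finset.prod_pos fun k _ => hp0 k)]
  have key (k : Fin d) : polyChain (subfacet p (Finset.univ.erase k)) f = 0 ↔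
      (X ^ ((∏ i, p i) / p k) - 1 : ℤ[X]) ∣ f := by
    rw [hdiv]
    exact polyChain_eq_zero_iff (Finset.prod_pos fun k _ => hp0 k)
      (subfacet_eq_iff hp0 hcop _) f
  constructor
  · intro h q hq hqn
    obtain ⟨k, -, hk⟩ := (Nat.prime_iff.1 hq).exists_mem_finset_dvd hqn
    rw [(Nat.prime_dvd_prime_iff_eq hq (hp k)).1 hk]
    exact (key k).1 (h k)
  · exact fun h k => (key k).2 (h _ (hp k) (Finset.dvd_prod_of_mem p (Finset.mem_univ k)))

/-! ### The chain groups of the subcomplexes -/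

theorem mem_subcomplex {A : Set ℕ} {s : Finset (Vertex p)} :
    s ∈ subcomplex p A ↔ s.Nonempty ∧
      ∃ l ∈ A ∪ Set.Ioo (Nat.totient (∏ i, p i)) (∏ i, p i), s ⊆ facet p l := Iff.rfl

/-- By the Chinese remainder theorem, each face of the complete partite complex lies in a facet
`facet p l`. -/
theorem exists_subset_facet (hp : ∀ k, 0 < p k) (hcop : Pairwise (Function.onFun Nat.Coprime p))
    {s : Finset (Vertex p)} (hs : s ∈ completePartite p ∨ s = ∅) : ∃ l, s ⊆ facet p l := by
  classical
  rw [mem_completePartite_or_eq_empty] at hs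
  let r : Fin d → ℕ := fun k =>
    if h : ∃ v ∈ s, (ofLex v).1 = k then ((ofLex h.choose).2 : ℕ) else 0
  obtain ⟨l, hl⟩ := Nat.chineseRemainderOfFinset r p Finset.univ (fun k _ => (hp k).ne')
    (fun i _ k _ hik => hcop hik)
  refine ⟨l, fun v hv => mem_facet.2 ?_⟩
  have h : ∃ w ∈ s, (ofLex w).1 = (ofLex v).1 := ⟨v, hv, rfl⟩
  have hr : r (ofLex v).1 = (ofLex v).2 := by
    have hvw := hs _ h.choose_spec.1 v hv h.choose_spec.2
    simp only [r, dif_pos h]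
    rw [hvw]
  have h1 : l ≡ r (ofLex v).1 [MOD p (ofLex v).1] := hl _ (Finset.mem_univ _)
  rw [h1, hr, Nat.mod_eq_of_lt (ofLex v).2.isLt]

theorem card_le_of_mem_completePartite (hp : ∀ k, 0 < p k)
    (hcop : Pairwise (Function.onFun Nat.Coprime p))
    {s : Finset (Vertex p)} (hs : s ∈ completePartite p ∨ s = ∅) : s.card ≤ d := by
  obtain ⟨l, hl⟩ := exists_subset_facet hp hcop hs
  exact (Finset.card_le_card hl).trans_eq (card_facet hp l)

theorem totient_mul_add_lt {q m : ℕ} (hq : q.Prime) (hm : 1 < m) (hqm : q.Coprime m) :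
    (q * m).totient + m < q * m := by
  have h1 := Nat.totient_lt m hm
  have h2 := hq.two_le
  rw [Nat.totient_mul hqm, Nat.totient_prime hq]
  obtain ⟨a, rfl⟩ := Nat.exists_eq_add_of_le' h2
  have h3 : a + 2 - 1 = a + 1 := by lia
  rw [h3]
  have h4 : a * (m.totient + 1) ≤ a * m := Nat.mul_le_mul_left a h1
  lia

/-- The facets `F_l` with `φ(n) < l < n` contain all faces of codimension at least one: each residue
class modulo `n / pₖ` is represented in that interval, which has at least `n / pₖ` elements when
`n ≠ pₖ`. -/
theorem mem_subcomplex_of_card_lt (hp : ∀ k, (p k).Prime)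
    (hcop : Pairwise (Function.onFun Nat.Coprime p)) (A : Set ℕ) {s : Finset (Vertex p)}
    (hs : s ∈ completePartite p) (hcard : s.card < d) : s ∈ subcomplex p A := by
  have hp0 : ∀ k, 0 < p k := fun k => (hp k).pos
  obtain ⟨l, hl⟩ := exists_subset_facet hp0 hcop (Or.inl hs)
  obtain ⟨k, hk⟩ : ∃ k, ¬ Meets s k := by
    by_contra! h
    exact hcard.not_ge (le_card_of_forall_meets h)
  set m := ∏ i ∈ Finset.univ.erase k, p i with hm
  have hn : ∏ i, p i = p k * m := (Finset.mul_prod_erase _ _ (Finset.mem_univ k)).symm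
  have hm1 : 1 < m := by
    obtain ⟨v, hv⟩ := hs.1
    have hvk : (ofLex v).1 ∈ Finset.univ.erase k :=
      Finset.mem_erase.2 ⟨fun h => hk ⟨v, hv, h⟩, Finset.mem_univ _⟩
    exact (hp _).one_lt.trans_le (Nat.le_of_dvd (Finset.prod_pos fun i _ => hp0 i)
      (Finset.dvd_prod_of_mem p hvk))
  have hlt : (∏ i, p i).totient + m < ∏ i, p i := by
    rw [hn]
    exact totient_mul_add_lt (hp k) hm1
      (Nat.Coprime.prod_right fun i hi => hcop (Finset.ne_of_mem_erase hi).symm)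
  set c := (∏ i, p i).totient + 1 with hc
  -- the representative of `l` modulo `m` in `[c, c + m)`
  set l' := c + (l + c * (m - 1)) % m with hl'
  have hmod : l' ≡ l [MOD m] := by
    have h1 : l' ≡ c + (l + c * (m - 1)) [MOD m] := (Nat.mod_modEq _ m).add_left c
    have h2 : c + (l + c * (m - 1)) = l + m * c := by
      obtain ⟨b, hb⟩ := Nat.exists_eq_add_of_lt hm1
      rw [hb]
      have : 1 + b + 1 - 1 = b + 1 := by lia
      rw [this]
      ring
    rw [h2] at h1
    exact h1.trans (by simp [Nat.ModEq])
  have hlm : (l + c * (m - 1)) % m < m := Nat.mod_lt _ (by lia)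
  refine mem_subcomplex.2 ⟨hs.1, l', Or.inr ⟨by lia, by lia⟩, fun v hv => ?_⟩
  rw [mem_facet, mem_facet.1 (hl hv)]
  exact ((modEq_prod_iff hcop _ _ _).1 hmod _
    (Finset.mem_erase.2 ⟨fun h => hk ⟨v, hv, h⟩, Finset.mem_univ _⟩)).symm

theorem chains_subcomplex_le (A : Set ℕ) (i : ℤ) :
    chains (subcomplex p A) i ≤ chains (completePartite p) i := by
  intro x hx
  rw [mem_chains_iff] at hx ⊢
  exact fun s hs => ⟨(hx s hs).1.imp_left fun h => subcomplex_le p A h, (hx s hs).2⟩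

theorem chains_subcomplex_eq (hp : ∀ k, (p k).Prime)
    (hcop : Pairwise (Function.onFun Nat.Coprime p)) (A : Set ℕ) {i : ℤ} (hi : i ≤ (d : ℤ) - 2) :
    chains (subcomplex p A) i = chains (completePartite p) i := by
  refine le_antisymm (chains_subcomplex_le A i) fun x hx => ?_
  rw [mem_chains_iff] at hx ⊢
  refine fun s hs => ⟨(hx s hs).1.imp_left fun h => ?_, (hx s hs).2⟩
  have := (hx s hs).2
  exact mem_subcomplex_of_card_lt hp hcop A h (by lia)

theorem chains_subcomplex_eq_bot (hp : ∀ k, (p k).Prime)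
    (hcop : Pairwise (Function.onFun Nat.Coprime p)) (A : Set ℕ) {i : ℤ} (hi : (d : ℤ) ≤ i) :
    chains (subcomplex p A) i = ⊥ := by
  refine eq_bot_iff.2 fun x hx => ?_
  have hx' := mem_chains_iff.1 (chains_subcomplex_le A i hx)
  rw [Submodule.mem_bot, ← Finsupp.support_eq_empty, Finset.eq_empty_iff_forall_notMem]
  intro s hs
  have h1 := card_le_of_mem_completePartite (fun k => (hp k).pos) hcop (hx' s hs).1
  have h2 := (hx' s hs).2
  lia

theorem chains_completePartite_top (hp : ∀ k, 0 < p k)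
    (hcop : Pairwise (Function.onFun Nat.Coprime p)) :
    chains (completePartite p) ((d : ℤ) - 1) =
      (supportedIn (Set.Iio (∏ k, p k))).map (polyChain (facet p)) := by
  rw [map_polyChain_supportedIn, chains]
  congr 1
  ext s
  constructor
  · rintro ⟨hs, hc⟩
    obtain ⟨l, hl⟩ := exists_subset_facet hp hcop hs
    refine ⟨l % ∏ k, p k, Nat.mod_lt _ (Finset.prod_pos fun k _ => hp k), ?_⟩
    rw [(facet_eq_iff hp hcop _ l).2 (Nat.mod_modEq _ _)]
    exact (Finset.eq_of_subset_of_card_le hl (by rw [card_facet hp]; lia)).symm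
  · rintro ⟨l, -, rfl⟩
    refine ⟨mem_completePartite_or_eq_empty.2 fun v hv w hw h => ?_, by rw [card_facet hp]; lia⟩
    rw [eq_vertexOf_of_mem_facet hp hv, eq_vertexOf_of_mem_facet hp hw, h]

theorem chains_subcomplex_top (hp : ∀ k, 0 < p k) (hd : 0 < d) (A : Set ℕ) :
    chains (subcomplex p A) ((d : ℤ) - 1) =
      (supportedIn (A ∪ Set.Ioo (Nat.totient (∏ i, p i)) (∏ i, p i))).map
        (polyChain (facet p)) := by
  rw [map_polyChain_supportedIn, chains]
  congr 1
  ext s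
  constructor
  · rintro ⟨hs | rfl, hc⟩
    · obtain ⟨-, l, hl, hsl⟩ := mem_subcomplex.1 hs
      exact ⟨l, hl, (Finset.eq_of_subset_of_card_le hsl (by rw [card_facet hp]; lia)).symm⟩
    · simp only [Finset.card_empty] at hc
      lia
  · rintro ⟨l, hl, rfl⟩
    have hc := card_facet hp l
    exact ⟨Or.inl (mem_subcomplex.2 ⟨Finset.card_pos.1 (by lia), l, hl, subset_rfl⟩), by lia⟩

/-! ### The top two homology groups -/

theorem degree_lt_of_mem_supportedIn {n j : ℕ} (hn : 1 < n) (hj : j ≤ n.totient) {f : ℤ[X]}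
    (hf : f ∈ supportedIn ({j} ∪ Set.Ioo n.totient n)) : f.degree < n := by
  refine mem_supportedIn_Iio.1 (supportedIn_mono ?_ hf)
  rintro l (rfl | hl)
  · exact hj.trans_lt (Nat.totient_lt n hn)
  · exact hl.2

theorem X_pow_dvd_sub_coeff_smul {n j : ℕ} {f : ℤ[X]}
    (hf : f ∈ supportedIn ({j} ∪ Set.Ioo n.totient n)) :
    X ^ (n.totient + 1) ∣ f - f.coeff j • (X ^ j : ℤ[X]) := by
  rw [X_pow_dvd_iff]
  intro l hl
  rw [coeff_sub, coeff_smul, coeff_X_pow, smul_eq_mul]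
  split_ifs with h
  · rw [h, mul_one, sub_self]
  · rw [mul_zero, sub_zero]
    refine hf l ?_
    rintro (h' | h')
    · exact h h'
    · exact absurd h'.1 (by lia)

theorem cycloFunctional_of_mem_supportedIn {n j : ℕ} (hn : 1 < n) (hj : j ≤ n.totient) {f : ℤ[X]}
    (hf : f ∈ supportedIn ({j} ∪ Set.Ioo n.totient n)) :
    cycloFunctional n f = f.coeff j * (cyclotomic n ℤ).coeff j := by
  have h := cycloFunctional_eq_zero_of_X_pow_dvd (X_pow_dvd_sub_coeff_smul hf)
  rwa [map_sub, map_smul, cycloFunctional_X_pow hn hj, smul_eq_mul, sub_eq_zero] at h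

/-- The functional takes values divisible by `cⱼ` exactly on the sums of a multiple of
`cocyclotomic n` and a polynomial supported on the exponents that index the facets of `K_{j}`. -/
theorem exists_cocyclotomic_dvd_sub_iff {n j : ℕ} (hn : 1 < n) (hj : j ≤ n.totient) {f : ℤ[X]}
    (hf : f.degree < n) :
    (∃ g ∈ supportedIn ({j} ∪ Set.Ioo n.totient n), cocyclotomic n ∣ f - g) ↔
      (cyclotomic n ℤ).coeff j ∣ cycloFunctional n f := by
  constructor
  · rintro ⟨g, hg, h⟩
    have hgn : g.degree < n := degree_lt_of_mem_supportedIn hn hj hg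
    have h1 := cycloFunctional_eq_zero_of_cocyclotomic_dvd hn
      ((degree_sub_le f g).trans_lt (max_lt hf hgn)) h
    rw [map_sub, sub_eq_zero, cycloFunctional_of_mem_supportedIn hn hj hg] at h1
    exact ⟨g.coeff j, by rw [h1, mul_comm]⟩
  · rintro ⟨a, ha⟩
    have h0 : cycloFunctional n (f - a • (X ^ j : ℤ[X])) = 0 := by
      rw [map_sub, map_smul, cycloFunctional_X_pow hn hj, ha, smul_eq_mul, mul_comm, sub_self]
    obtain ⟨g, hg, hgn, hX⟩ := exists_cocyclotomic_dvd_of_cycloFunctional_eq_zero hn h0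
    refine ⟨f - g, fun l hl => ?_, by rwa [sub_sub_cancel]⟩
    rw [Set.mem_union, not_or, Set.mem_singleton_iff, Set.mem_Ioo, not_and_or, not_lt, not_lt] at hl
    rcases hl.2 with h | h
    · have := X_pow_dvd_iff.1 hX l (Nat.lt_succ_of_le h)
      rwa [sub_right_comm, coeff_sub, coeff_smul, coeff_X_pow, if_neg hl.1, smul_zero,
        sub_zero] at this
    · rw [coeff_sub, degree_lt_iff_coeff_zero _ _ |>.1 hf l h,
        degree_lt_iff_coeff_zero _ _ |>.1 hgn l h, sub_zero]

theorem subsingleton_reducedHomology {V : Type*} [LinearOrder V]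
    {K : PreAbstractSimplicialComplex V} {i : ℤ} (h : cycles K i ≤ boundaries K i) :
    Subsingleton (reducedHomology K i) := by
  exact Submodule.Quotient.subsingleton_iff.2 (Submodule.submoduleOf_eq_top.2 h)

/-- The isomorphism is induced by `cycloFunctional n`: both groups are quotients of the polynomials
of degree less than `n`, with the same kernel. -/
theorem nonempty_reducedHomology_equiv (hd : 0 < d) (hp : ∀ k, (p k).Prime)
    (hcop : Pairwise (Function.onFun Nat.Coprime p)) (hn : 1 < ∏ k, p k) {j : ℕ}
    (hj : j ≤ Nat.totient (∏ k, p k)) :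
    Nonempty (reducedHomology (subcomplex p {j}) ((d : ℤ) - 2) ≃ₗ[ℤ]
      ℤ ⧸ Ideal.span {(cyclotomic (∏ k, p k) ℤ).coeff j}) := by
  have hp0 : ∀ k, 0 < p k := fun k => (hp k).pos
  set n := ∏ k, p k with hndef
  have hd1 : (d : ℤ) - 2 + 1 = (d : ℤ) - 1 := by ring
  let D : ℤ[X] →ₗ[ℤ] (Finset (Vertex p) →₀ ℤ) := boundary (Vertex p) ∘ₗ polyChain (facet p)
  have hcyc : cycles (subcomplex p {j}) ((d : ℤ) - 2) = (supportedIn (Set.Iio n)).map D := by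
    rw [cycles, chains_subcomplex_eq hp hcop _ le_rfl, ← cycles,
      le_antisymm (cycles_completePartite_le_boundaries hp0 (by lia)) (boundaries_le_cycles _ _),
      boundaries, hd1, chains_completePartite_top hp0 hcop, Submodule.map_comp]
  have hbd : boundaries (subcomplex p {j}) ((d : ℤ) - 2) =
      (supportedIn ({j} ∪ Set.Ioo n.totient n)).map D := by
    rw [boundaries, hd1, chains_subcomplex_top hp0 hd, Submodule.map_comp]
  let α : supportedIn (Set.Iio n) →ₗ[ℤ] cycles (subcomplex p {j}) ((d : ℤ) - 2) :=
    D.restrict fun f hf => hcyc ▸ Submodule.mem_map_of_mem hf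
  have hα : Function.Surjective α := by
    rintro ⟨z, hz⟩
    obtain ⟨f, hf, rfl⟩ := hcyc ▸ hz
    exact ⟨⟨f, hf⟩, rfl⟩
  let α' := ((boundaries (subcomplex p {j}) ((d : ℤ) - 2)).submoduleOf _).mkQ ∘ₗ α
  let β' := (Ideal.span {(cyclotomic n ℤ).coeff j} : Submodule ℤ ℤ).mkQ ∘ₗ
    cycloFunctional n ∘ₗ (supportedIn (Set.Iio n)).subtype
  have hα' : Function.Surjective α' := (Submodule.mkQ_surjective _).comp hα
  have hβ' : Function.Surjective β' := by
    refine (Submodule.mkQ_surjective _).comp fun a => ?_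
    refine ⟨a • ⟨X ^ n.totient, X_pow_mem_supportedIn (Nat.totient_lt n hn)⟩, ?_⟩
    rw [map_smul]
    have h1 := cycloFunctional_X_pow hn le_rfl
    rw [← cyclotomic_coeff_totient_sub hn le_rfl, Nat.sub_self, cyclotomic_coeff_zero ℤ hn] at h1
    simp [h1]
  have hker : LinearMap.ker α' = LinearMap.ker β' := by
    ext ⟨f, hf⟩
    have h1 : α' ⟨f, hf⟩ = 0 ↔ D f ∈ boundaries (subcomplex p {j}) ((d : ℤ) - 2) :=
      Submodule.Quotient.mk_eq_zero _
    have h2 : β' ⟨f, hf⟩ = 0 ↔ cycloFunctional n f ∈ Ideal.span {(cyclotomic n ℤ).coeff j} :=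
      Submodule.Quotient.mk_eq_zero _
    rw [LinearMap.mem_ker, LinearMap.mem_ker, h1, h2, Ideal.mem_span_singleton,
      ← exists_cocyclotomic_dvd_sub_iff hn hj (mem_supportedIn_Iio.1 hf), hbd, Submodule.mem_map]
    refine exists_congr fun g => and_congr_right fun _ => ?_
    rw [hndef, ← boundary_polyChain_facet_eq_zero_iff_cocyclotomic_dvd hp hcop, eq_comm,
      ← sub_eq_zero, ← map_sub]
    rfl
  exact ⟨(α'.quotKerEquivOfSurjective hα').symm ≪≫ₗ Submodule.quotEquivOfEq _ _ hker ≪≫ₗ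
    β'.quotKerEquivOfSurjective hβ'⟩

theorem mem_cycles_subcomplex_top_iff (hd : 0 < d) (hp : ∀ k, (p k).Prime)
    (hcop : Pairwise (Function.onFun Nat.Coprime p)) {A : Set ℕ} {z : Finset (Vertex p) →₀ ℤ} :
    z ∈ cycles (subcomplex p A) ((d : ℤ) - 1) ↔
      ∃ f ∈ supportedIn (A ∪ Set.Ioo (Nat.totient (∏ i, p i)) (∏ i, p i)),
        cocyclotomic (∏ i, p i) ∣ f ∧ polyChain (facet p) f = z := by
  rw [cycles, chains_subcomplex_top (fun k => (hp k).pos) hd]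
  constructor
  · rintro ⟨⟨f, hf, rfl⟩, hz⟩
    exact ⟨f, hf, (boundary_polyChain_facet_eq_zero_iff_cocyclotomic_dvd hp hcop f).1 hz, rfl⟩
  · rintro ⟨f, hf, hz, rfl⟩
    exact ⟨⟨f, hf, rfl⟩, (boundary_polyChain_facet_eq_zero_iff_cocyclotomic_dvd hp hcop f).2 hz⟩

/-- A multiple of `cocyclotomic n` supported on the exponents that index the facets of `K_{j}` is
determined by its coefficient at `X ^ j`. -/
theorem eq_zero_of_coeff_eq_zero {n j : ℕ} (hn : 1 < n) (hj : j ≤ n.totient) {f : ℤ[X]}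
    (hf : f ∈ supportedIn ({j} ∪ Set.Ioo n.totient n)) (h : cocyclotomic n ∣ f)
    (h0 : f.coeff j = 0) : f = 0 := by
  have hX := X_pow_dvd_sub_coeff_smul hf
  rw [h0, zero_smul, sub_zero] at hX
  exact eq_zero_of_cocyclotomic_dvd_of_X_pow_dvd hn (degree_lt_of_mem_supportedIn hn hj hf) h
    ((pow_dvd_pow X (Nat.le_succ _)).trans hX)

theorem cycles_top_eq_bot (hd : 0 < d) (hp : ∀ k, (p k).Prime)
    (hcop : Pairwise (Function.onFun Nat.Coprime p)) (hn : 1 < ∏ k, p k) {j : ℕ}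
    (hj : j ≤ Nat.totient (∏ k, p k)) (hc : (cyclotomic (∏ k, p k) ℤ).coeff j ≠ 0) :
    cycles (subcomplex p {j}) ((d : ℤ) - 1) = ⊥ := by
  refine eq_bot_iff.2 fun z hz => ?_
  obtain ⟨f, hf, h, rfl⟩ := (mem_cycles_subcomplex_top_iff hd hp hcop).1 hz
  have h1 := cycloFunctional_eq_zero_of_cocyclotomic_dvd hn
    (degree_lt_of_mem_supportedIn hn hj hf) h
  rw [cycloFunctional_of_mem_supportedIn hn hj hf, mul_eq_zero] at h1
  rw [eq_zero_of_coeff_eq_zero hn hj hf h (h1.resolve_right hc), map_zero]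
  exact Submodule.zero_mem _

theorem boundaries_top_eq_bot (hp : ∀ k, (p k).Prime)
    (hcop : Pairwise (Function.onFun Nat.Coprime p)) (A : Set ℕ) :
    boundaries (subcomplex p A) ((d : ℤ) - 1) = ⊥ := by
  rw [boundaries, chains_subcomplex_eq_bot hp hcop A (by lia), Submodule.map_bot]

/-- The isomorphism evaluates a cycle at the facet `F_j`. -/
theorem nonempty_reducedHomology_top_equiv (hd : 0 < d) (hp : ∀ k, (p k).Prime)
    (hcop : Pairwise (Function.onFun Nat.Coprime p)) (hn : 1 < ∏ k, p k) {j : ℕ}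
    (hj : j ≤ Nat.totient (∏ k, p k)) (hc : (cyclotomic (∏ k, p k) ℤ).coeff j = 0) :
    Nonempty (reducedHomology (subcomplex p {j}) ((d : ℤ) - 1) ≃ₗ[ℤ] ℤ) := by
  have hp0 : ∀ k, 0 < p k := fun k => (hp k).pos
  have hjn := hj.trans_lt (Nat.totient_lt _ hn)
  let e : cycles (subcomplex p {j}) ((d : ℤ) - 1) →ₗ[ℤ] ℤ :=
    Finsupp.lapply (facet p j) ∘ₗ Submodule.subtype _
  have heval {f : ℤ[X]} (hf : f ∈ supportedIn ({j} ∪ Set.Ioo (∏ k, p k).totient (∏ k, p k))) :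
      polyChain (facet p) f (facet p j) = f.coeff j :=
    polyChain_apply_of_degree_lt (facet_eq_iff hp0 hcop) (degree_lt_of_mem_supportedIn hn hj hf) hjn
  have hinj : Function.Injective e := by
    refine LinearMap.ker_eq_bot.1 (LinearMap.ker_eq_bot'.2 ?_)
    rintro ⟨z, hz⟩ h0
    obtain ⟨f, hf, h, rfl⟩ := (mem_cycles_subcomplex_top_iff hd hp hcop).1 hz
    have h1 : polyChain (facet p) f (facet p j) = 0 := h0
    rw [heval hf] at h1
    refine Subtype.ext ?_
    simp only [eq_zero_of_coeff_eq_zero hn hj hf h h1, map_zero, ZeroMemClass.coe_zero]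
  have hsurj : Function.Surjective e := by
    intro a
    -- a multiple of `cocyclotomic n` that agrees with `a Xʲ` up to degree `φ(n)`
    have h0 : cycloFunctional (∏ k, p k) (a • (X ^ j : ℤ[X])) = 0 := by
      rw [map_smul, cycloFunctional_X_pow hn hj, hc, smul_zero]
    obtain ⟨g, hg, hgn, hX⟩ := exists_cocyclotomic_dvd_of_cycloFunctional_eq_zero hn h0
    have hcoeff {l : ℕ} (hl : l ≤ (∏ k, p k).totient) :
        g.coeff l = if l = j then a else 0 := by
      have := X_pow_dvd_iff.1 hX l (Nat.lt_succ_of_le hl)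
      rw [coeff_sub, coeff_smul, coeff_X_pow, sub_eq_zero] at this
      rw [← this]
      simp
    have hgs : g ∈ supportedIn ({j} ∪ Set.Ioo (∏ k, p k).totient (∏ k, p k)) := by
      intro l hl
      rw [Set.mem_union, not_or, Set.mem_singleton_iff, Set.mem_Ioo, not_and_or, not_lt,
        not_lt] at hl
      rcases hl.2 with h | h
      · rw [hcoeff h, if_neg hl.1]
      · exact degree_lt_iff_coeff_zero _ _ |>.1 hgn l h
    refine ⟨⟨_, (mem_cycles_subcomplex_top_iff hd hp hcop).2 ⟨g, hgs, hg, rfl⟩⟩, ?_⟩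
    exact (heval hgs).trans ((hcoeff hj).trans (if_pos rfl))
  have hbot : (boundaries (subcomplex p {j}) ((d : ℤ) - 1)).submoduleOf
      (cycles (subcomplex p {j}) ((d : ℤ) - 1)) = ⊥ := by
    rw [boundaries_top_eq_bot hp hcop, Submodule.submoduleOf, Submodule.comap_bot,
      Submodule.ker_subtype]
  exact ⟨Submodule.quotEquivOfEqBot _ hbot ≪≫ₗ LinearEquiv.ofBijective e ⟨hinj, hsurj⟩⟩

theorem subsingleton_reducedHomology_subcomplex (hd : 0 < d) (hp : ∀ k, (p k).Prime)
    (hcop : Pairwise (Function.onFun Nat.Coprime p)) (hn : 1 < ∏ k, p k) {j : ℕ}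
    (hj : j ≤ Nat.totient (∏ k, p k)) {i : ℤ} (hi2 : i ≠ (d : ℤ) - 2)
    (hi1 : ¬(i = (d : ℤ) - 1 ∧ (cyclotomic (∏ k, p k) ℤ).coeff j = 0)) :
    Subsingleton (reducedHomology (subcomplex p {j}) i) := by
  apply subsingleton_reducedHomology
  rcases lt_trichotomy i ((d : ℤ) - 1) with hlt | rfl | hgt
  · rw [cycles, boundaries, chains_subcomplex_eq hp hcop _ (by lia : i ≤ (d : ℤ) - 2),
      chains_subcomplex_eq hp hcop _ (by lia : i + 1 ≤ (d : ℤ) - 2)]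
    exact cycles_completePartite_le_boundaries (fun k => (hp k).pos) hlt
  · rw [cycles_top_eq_bot hd hp hcop hn hj fun hc => hi1 ⟨rfl, hc⟩]
    exact bot_le
  · rw [cycles, chains_subcomplex_eq_bot hp hcop _ (by lia), bot_inf_eq]
    exact bot_le

theorem pairwise_coprime_of_squarefree_prod (hp : ∀ k, (p k).Prime)
    (hsq : Squarefree (∏ k, p k)) : Pairwise (Function.onFun Nat.Coprime p) := by
  intro i k hik
  refine (Nat.coprime_primes (hp i) (hp k)).2 fun h => (hp i).not_isUnit (hsq (p i) ?_)
  rw [← Finset.mul_prod_erase _ _ (Finset.mem_univ i)]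
  refine mul_dvd_mul_left _ ?_
  nth_rw 1 [h]
  exact Finset.dvd_prod_of_mem p (Finset.mem_erase.2 ⟨hik.symm, Finset.mem_univ k⟩)

end CyclotomicComplex

theorem theorem1 {d : ℕ} (hd : 0 < d) (p : Fin d → ℕ) (hp : ∀ i, (p i).Prime)
    (n : ℕ) (hn : Squarefree n) (hnp : n = ∏ i, p i)
    (j : ℕ) (hj : j ≤ Nat.totient n) :
    Nonempty (SimplicialHomology.reducedHomology (CyclotomicComplex.subcomplex p {j})
        ((d : ℤ) - 2) ≃ₗ[ℤ] ℤ ⧸ Ideal.span {(Polynomial.cyclotomic n ℤ).coeff j}) ∧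
    ((Polynomial.cyclotomic n ℤ).coeff j = 0 →
      Nonempty (SimplicialHomology.reducedHomology (CyclotomicComplex.subcomplex p {j})
        ((d : ℤ) - 1) ≃ₗ[ℤ] ℤ)) ∧
    (∀ i : ℤ, i ≠ (d : ℤ) - 2 →
      ¬(i = (d : ℤ) - 1 ∧ (Polynomial.cyclotomic n ℤ).coeff j = 0) →
      Subsingleton (SimplicialHomology.reducedHomology (CyclotomicComplex.subcomplex p {j}) i)) := by
  subst hnp
  have hcop := CyclotomicComplex.pairwise_coprime_of_squarefree_prod hp hn
  have hn1 : 1 < ∏ k, p k :=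
    (hp ⟨0, hd⟩).one_lt.trans_le (Nat.le_of_dvd (Finset.prod_pos fun k _ => (hp k).pos)
      (Finset.dvd_prod_of_mem p (Finset.mem_univ _)))
  refine ⟨CyclotomicComplex.nonempty_reducedHomology_equiv hd hp hcop hn1 hj,
    CyclotomicComplex.nonempty_reducedHomology_top_equiv hd hp hcop hn1 hj, fun i hi2 hi1 =>
    CyclotomicComplex.subsingleton_reducedHomology_subcomplex hd hp hcop hn1 hj hi2 hi1⟩
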